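/- Let $q$ be a prime power, let $V$ be an $n$-dimensional vector space over the finite field $\mathbb{F}_q$, and for an integer $m\ge 0$ write ${V\brack m}$ for the set of all $m$-dimensional subspaces of $V$. A family $\mathcal{F}\subseteq{V\brack k}$ is called $t$-intersecting if $\dim(F_1\cap F_2)\geq t$ for all $F_1,F_2\in\mathcal{F}$, and almost $t$-intersecting if for each $F\in\mathcal{F}$ there is at most one $F'\in\mathcal{F}$ with $\dim(F\cap F')<t$. Let $n$, $k$ and $t$ be positive integers with $k\geq t+1$ and $n\geq 2k+1+\delta_{2,q}(1-\delta_{k,t+1})$, where $\delta$ is the Kronecker delta (that is, $n\ge 2k+2$ if $q=2$ and $k\neq t+1$, and $n\geq 2k+1$ otherwise). If $\mathcal{F}\subseteq{V\brack k}$ is an almost $t$-intersecting family of maximum size among all almost $t$-intersecting families contained in ${V\brack k}$, then there exists $E\in{V\brack t}$ such that $$\mathcal{F}=\left\{F\in{V\brack k}: E\subseteq F\right\}.$$ In particular, $\mathcal{F}$ is $t$-intersecting. -/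

import Mathlib

namespace AlmostIntersecting

variable {K V : Type*} [Field K] [AddCommGroup V] [Module K V]

/-- The family of all `k`-dimensional subspaces of `V`. -/
def subspacesOfDim (K V : Type*) [Field K] [AddCommGroup V] [Module K V] (k : ℕ) :
    Set (Submodule K V) :=
  {F | Module.finrank K F = k}

/-- Any two members of the family (possibly equal) meet in dimension at least `t`. -/
def IsTIntersecting (t : ℕ) (𝓕 : Set (Submodule K V)) : Prop :=
  ∀ F₁ ∈ 𝓕, ∀ F₂ ∈ 𝓕, t ≤ Module.finrank K (F₁ ⊓ F₂ : Submodule K V)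

/-- For each member `F` there is at most one member `F'` with `dim (F ∩ F') < t`. -/
def IsAlmostTIntersecting (t : ℕ) (𝓕 : Set (Submodule K V)) : Prop :=
  ∀ F ∈ 𝓕, {F' ∈ 𝓕 | Module.finrank K (F ⊓ F' : Submodule K V) < t}.Subsingleton

/-- `𝓕` is an almost `t`-intersecting family of `k`-subspaces of `V`, and no such family has more
members. (Over a finite field and in finite dimension all families are finite, so `Set.ncard` is
the true cardinality.) -/
def IsMaximumAlmostTIntersecting (k t : ℕ) (𝓕 : Set (Submodule K V)) : Prop :=
  𝓕 ⊆ subspacesOfDim K V k ∧ IsAlmostTIntersecting t 𝓕 ∧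
    ∀ 𝓖 : Set (Submodule K V), 𝓖 ⊆ subspacesOfDim K V k → IsAlmostTIntersecting t 𝓖 →
      𝓖.ncard ≤ 𝓕.ncard

/-- The Kronecker delta on natural numbers. -/
def delta (i j : ℕ) : ℕ := if i = j then 1 else 0

end AlmostIntersecting

namespace AlmostIntersecting

open Module Finset

/-! All `k`-spaces through a fixed `t`-space form a `t`-intersecting family of size `gauss q (k - t)
(n - k)`, so a maximum family `S` is at least this large. It remains to show that a family of this
size has all its members through one `t`-space.

Each member of `S` is an almost-cover: it meets all members but at most one in dimension at least
`t`. Let `T` be an almost-cover of least dimension `t + s`. Any `U` with `t ≤ dim U < t + s` then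
has some `B` in `S` with `dim (U ∩ B) < t`. A subspace `C` of `B` of dimension `k - t + 1` avoids
`U`, yet every `F` in `S` with `dim (F ∩ B) ≥ t` meets `C`. So, with at most one exception, the
members through `U` pass through one of `[k - t + 1]` covers of `U`
(`card_le_of_forall_le_finrank_inf`). Iterating `s` times from each `t`-subspace of `T` bounds `S`
(`card_le_of_isAlmostCover`).

For `s ≥ 1` this bound is below the star size. For `s = 0`, either every member contains `T`, or a
single branching at the exceptional member already makes `S` too small (`card_le_of_not_le`). -/

/-- The Gaussian binomial coefficient `[b + d, b]` with parameter `q`. -/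
def gauss (q : ℚ) : ℕ → ℕ → ℚ
  | 0, _ => 1
  | b + 1, d => gauss q b d * (q ^ (d + b + 1) - 1) / (q ^ (b + 1) - 1)

/-- The `q`-analogue `[m] = (q ^ m - 1) / (q - 1)` of the number `m`. -/
def qnum (q : ℚ) (m : ℕ) : ℚ := (q ^ m - 1) / (q - 1)

/-! ### Linear algebra: dimensions and complements. -/

section FiniteDimensional

variable {K V : Type*} [Field K] [AddCommGroup V] [Module K V]

lemma exists_le_finrank_eq (W : Submodule K V) {d : ℕ} (hd : d ≤ finrank K W) :
    ∃ E ≤ W, finrank K E = d := by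
  obtain ⟨f, hf⟩ := exists_linearIndependent_of_le_finrank hd
  refine ⟨(Submodule.span K (Set.range f)).map W.subtype, Submodule.map_subtype_le _ _, ?_⟩
  rw [Submodule.finrank_map_subtype_eq, finrank_span_eq_card hf, Fintype.card_fin]

variable [FiniteDimensional K V]

lemma finrank_sup_span_singleton {U : Submodule K V} {v : V} (hv : v ∉ U) :
    finrank K (U ⊔ K ∙ v : Submodule K V) = finrank K U + 1 := by
  have h := Submodule.finrank_sup_add_finrank_inf_eq U (K ∙ v)
  have hv0 : v ≠ 0 := fun h0 => hv (h0 ▸ U.zero_mem)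
  have hd : U ⊓ (K ∙ v) = ⊥ := by
    rw [← disjoint_iff]
    exact (Submodule.disjoint_span_singleton' hv0).2 hv
  rw [hd, finrank_bot, finrank_span_singleton hv0] at h
  simpa using h

/-- If `U` meets `B` in dimension less than `t`, then `B` has a subspace of dimension
`dim B - t + 1` that meets `U` trivially. -/
lemma exists_le_disjoint_finrank_eq {U B : Submodule K V} {t d : ℕ}
    (hUB : finrank K (U ⊓ B : Submodule K V) < t) (hB : finrank K B + 1 = t + d) :
    ∃ C ≤ B, Disjoint U C ∧ finrank K C = d := by
  obtain ⟨C, hC⟩ := Submodule.exists_isCompl (U.comap B.subtype)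
  have h1 := Submodule.finrank_add_eq_of_isCompl hC
  have h2 : finrank K (U.comap B.subtype) = finrank K (U ⊓ B : Submodule K V) := by
    rw [← Submodule.finrank_map_subtype_eq, Submodule.map_comap_subtype, inf_comm]
  obtain ⟨D, hDC, hD⟩ := exists_le_finrank_eq (C.map B.subtype) (d := d) (by
    rw [Submodule.finrank_map_subtype_eq]; omega)
  refine ⟨D, hDC.trans (Submodule.map_subtype_le _ _), ?_, hD⟩
  refine Disjoint.mono_right hDC ?_
  rw [Submodule.disjoint_def]
  rintro x hxU ⟨y, hyC, rfl⟩
  have := Submodule.disjoint_def.1 hC.disjoint y hxU hyC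
  simp [this]

lemma ncard_diff [Finite K] {U W : Submodule K V} (h : U ≤ W) :
    (((W : Set V) \ (U : Set V)).ncard : ℚ) =
      (Nat.card K : ℚ) ^ finrank K W - (Nat.card K : ℚ) ^ finrank K U := by
  have : Finite V := Module.finite_of_finite K
  have h1 : ∀ U : Submodule K V, (U : Set V).ncard = Nat.card K ^ finrank K U := fun U => by
    rw [← Module.natCard_eq_pow_finrank (K := K) (V := U)]
    rfl
  have h2 := Set.ncard_sdiff_add_ncard_of_subset (s := (U : Set V)) (t := W) h (Set.toFinite _)
  rw [h1, h1] at h2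
  rw [eq_sub_iff_add_eq]
  exact_mod_cast h2

lemma one_lt_natCard (K : Type*) [Field K] [Finite K] : (1 : ℚ) < Nat.card K := by
  exact_mod_cast Finite.one_lt_card (α := K)

end FiniteDimensional

/-! ### Counting subspaces in an interval, and the branching bound. -/

section Counting

variable {K V : Type*} [Field K] [AddCommGroup V] [Module K V] [Fintype (Submodule K V)]

open Classical in
/-- The `d`-dimensional subspaces between `U` and `W`. -/
noncomputable def between (U W : Submodule K V) (d : ℕ) : Finset (Submodule K V) :=
  univ.filter fun F => U ≤ F ∧ F ≤ W ∧ finrank K F = d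

lemma mem_between {U W F : Submodule K V} {d : ℕ} :
    F ∈ between U W d ↔ U ≤ F ∧ F ≤ W ∧ finrank K F = d := by
  simp [between]

variable [Finite K] [FiniteDimensional K V]

/-- The number of subspaces of `W` covering `U`. -/
lemma card_between_succ {U W : Submodule K V} (h : U ≤ W) {m : ℕ}
    (hm : finrank K W = finrank K U + m) :
    ((between U W (finrank K U + 1)).card : ℚ) = qnum (Nat.card K) m := by
  classical
  have : Finite V := Module.finite_of_finite K
  have : Fintype V := Fintype.ofFinite V
  set q : ℚ := (Nat.card K : ℚ) with hq
  have hq1 : 1 < q := one_lt_natCard K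
  set S : Finset V := univ.filter fun v => v ∈ W ∧ v ∉ U with hS
  have hcard : ∀ {A B : Submodule K V}, A ≤ B →
      ((univ.filter fun v => v ∈ B ∧ v ∉ A).card : ℚ) = q ^ finrank K B - q ^ finrank K A := by
    intro A B hAB
    rw [← ncard_diff hAB, ← Set.ncard_coe_finset]
    congr 2
    ext v
    simp
  have hmaps : ∀ v ∈ S, U ⊔ K ∙ v ∈ between U W (finrank K U + 1) := by
    intro v hv
    simp only [hS, mem_filter, mem_univ, true_and] at hv
    rw [mem_between]
    exact ⟨le_sup_left, sup_le h (by simpa using hv.1), finrank_sup_span_singleton hv.2⟩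
  have hfib := card_eq_sum_card_fiberwise hmaps
  -- The vectors that generate `U'` over `U` are exactly those of `U' \ U`.
  have hfibre : ∀ U' ∈ between U W (finrank K U + 1),
      ((S.filter fun v => U ⊔ K ∙ v = U').card : ℚ) = q ^ (finrank K U + 1) - q ^ finrank K U := by
    intro U' hU'
    rw [mem_between] at hU'
    rw [← hU'.2.2, ← hcard hU'.1]
    congr 2
    ext v
    simp only [hS, mem_filter, mem_univ, true_and]
    constructor
    · rintro ⟨⟨hW, hU⟩, rfl⟩
      exact ⟨Submodule.mem_sup_right (Submodule.mem_span_singleton_self v), hU⟩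
    · rintro ⟨hv, hU⟩
      refine ⟨⟨hU'.2.1 hv, hU⟩, ?_⟩
      apply Submodule.eq_of_le_of_finrank_eq (sup_le hU'.1 (by simpa using hv))
      rw [finrank_sup_span_singleton hU, hU'.2.2]
  have hq2 : (S.card : ℚ) = (between U W (finrank K U + 1)).card *
      (q ^ (finrank K U + 1) - q ^ finrank K U) := by
    rw [hfib, Nat.cast_sum, sum_congr rfl hfibre, sum_const, nsmul_eq_mul]
  rw [hcard h, hm] at hq2
  have hpos : 0 < q ^ finrank K U := by positivity
  rw [qnum, eq_div_iff (by linarith)]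
  apply mul_left_cancel₀ hpos.ne'
  rw [pow_add, pow_succ] at hq2
  linear_combination -hq2

/-- The number of subspaces of relative dimension `b` between `U` and `W`. -/
lemma card_between (b : ℕ) : ∀ {U W : Submodule K V} {d : ℕ}, U ≤ W →
    finrank K W = finrank K U + b + d →
    ((between U W (finrank K U + b)).card : ℚ) = gauss (Nat.card K) b d := by
  classical
  induction b with
  | zero =>
    intro U W d h _
    have : between U W (finrank K U + 0) = {U} := by
      ext F
      rw [mem_between, mem_singleton]
      constructor
      · rintro ⟨h1, h2, h3⟩
        exact (Submodule.eq_of_le_of_finrank_eq h1 (by omega)).symm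
      · rintro rfl
        exact ⟨le_rfl, h, rfl⟩
    rw [this]
    simp [gauss]
  | succ b ih =>
    intro U W d h hd
    set q : ℚ := (Nat.card K : ℚ) with hq
    have hq1 : 1 < q := one_lt_natCard K
    -- Double counting of pairs `U' ≤ F` with `U'` covering `U`.
    have key := sum_card_bipartiteAbove_eq_sum_card_bipartiteBelow
      (s := between U W (finrank K U + 1)) (t := between U W (finrank K U + (b + 1)))
      (fun U' F => U' ≤ F)
    have h1 : ∀ U' ∈ between U W (finrank K U + 1),
        ((bipartiteAbove (fun U' F : Submodule K V => U' ≤ F)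
          (between U W (finrank K U + (b + 1))) U').card : ℚ) = gauss q b d := by
      intro U' hU'
      rw [mem_between] at hU'
      rw [← ih hU'.2.1 (by omega)]
      congr 2
      ext F
      simp only [mem_bipartiteAbove, mem_between]
      constructor
      · rintro ⟨⟨h1, h2, h3⟩, h4⟩
        exact ⟨h4, h2, by omega⟩
      · rintro ⟨h1, h2, h3⟩
        exact ⟨⟨hU'.1.trans h1, h2, by omega⟩, h1⟩
    have h2 : ∀ F ∈ between U W (finrank K U + (b + 1)),
        ((bipartiteBelow (fun U' F : Submodule K V => U' ≤ F)
          (between U W (finrank K U + 1)) F).card : ℚ) = qnum q (b + 1) := by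
      intro F hF
      rw [mem_between] at hF
      rw [← card_between_succ hF.1 hF.2.2]
      congr 2
      ext U'
      simp only [mem_bipartiteBelow, mem_between]
      constructor
      · rintro ⟨⟨h1, h2, h3⟩, h4⟩
        exact ⟨h1, h4, h3⟩
      · rintro ⟨h1, h2, h3⟩
        exact ⟨⟨h1, h2.trans hF.2.1, h3⟩, h2⟩
    have key' := congrArg (Nat.cast (R := ℚ)) key
    rw [Nat.cast_sum, Nat.cast_sum, sum_congr rfl h1, sum_congr rfl h2, sum_const, sum_const,
      nsmul_eq_mul, nsmul_eq_mul, card_between_succ h (m := d + b + 1) (by omega)] at key'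
    have hpos : 0 < q ^ (b + 1) - 1 := sub_pos.2 (one_lt_pow₀ hq1 (by omega))
    have hpos1 : 0 < q - 1 := sub_pos.2 hq1
    rw [gauss, eq_div_iff hpos.ne']
    simp only [qnum, ← hq] at key'
    field_simp at key'
    linear_combination -key'

open Classical in
/-- Members of a family that contain `U` and meet `B` in dimension at least `t` are distributed
over `[dim B - t + 1]` subspaces covering `U`, if `dim (U ⊓ B) < t`. -/
lemma card_le_of_forall_le_finrank_inf {U B : Submodule K V} {t d : ℕ}
    (hUB : finrank K (U ⊓ B : Submodule K V) < t) (hB : finrank K B + 1 = t + d)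
    (S : Finset (Submodule K V)) (hU : ∀ F ∈ S, U ≤ F)
    (hS : ∀ F ∈ S, t ≤ finrank K (F ⊓ B : Submodule K V)) {M : ℚ}
    (hM : ∀ U' : Submodule K V, U ≤ U' → finrank K U' = finrank K U + 1 →
      ((S.filter fun F => U' ≤ F).card : ℚ) ≤ M) :
    (S.card : ℚ) ≤ qnum (Nat.card K) d * M := by
  obtain ⟨C, hCB, hUC, hC⟩ := exists_le_disjoint_finrank_eq hUB hB
  have hW : finrank K (U ⊔ C : Submodule K V) = finrank K U + d := by
    have h := Submodule.finrank_sup_add_finrank_inf_eq U C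
    rw [hUC.eq_bot, finrank_bot, hC] at h
    exact h
  rw [← card_between_succ le_sup_left hW, ← nsmul_eq_mul, ← sum_const]
  have hsub : S ⊆ (between U (U ⊔ C) (finrank K U + 1)).biUnion
      fun U' => S.filter fun F => U' ≤ F := by
    intro F hF
    obtain ⟨v, hvF, hvC, hv⟩ : ∃ v, v ∈ F ∧ v ∈ C ∧ v ∉ U := by
      have h1 := Submodule.finrank_sup_add_finrank_inf_eq (F ⊓ B) C
      have h2 := Submodule.finrank_mono (R := K) (sup_le (inf_le_right : F ⊓ B ≤ B) hCB)
      have h3 := hS F hF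
      -- Both spaces lie in `B`, and their dimensions add up to at least `t + d = dim B + 1`.
      have h4 : (F ⊓ B) ⊓ C ≠ ⊥ := by
        intro h
        rw [h, finrank_bot] at h1
        omega
      obtain ⟨v, hv, hv0⟩ := Submodule.exists_mem_ne_zero_of_ne_bot h4
      refine ⟨v, hv.1.1, hv.2, fun hvU => hv0 ?_⟩
      exact Submodule.disjoint_def.1 hUC v hvU hv.2
    rw [mem_biUnion]
    refine ⟨U ⊔ K ∙ v, ?_, ?_⟩
    · rw [mem_between]
      exact ⟨le_sup_left, sup_le_sup_left (by simpa using hvC) _, finrank_sup_span_singleton hv⟩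
    · rw [mem_filter]
      exact ⟨hF, sup_le (hU F hF) (by simpa using hvF)⟩
  calc (S.card : ℚ) ≤ _ := Nat.cast_le.2 ((card_le_card hsub).trans card_biUnion_le)
    _ ≤ _ := by
      rw [Nat.cast_sum]
      refine sum_le_sum fun U' hU' => ?_
      rw [mem_between] at hU'
      exact hM U' hU'.1 hU'.2.2

end Counting

/-! ### Estimates for Gaussian binomials. -/

section Numerics

variable {q : ℚ}

lemma gauss_pos (hq : 1 < q) (b d : ℕ) : 0 < gauss q b d := by
  induction b with
  | zero => simp [gauss]
  | succ b ih =>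
    have h1 : 0 < q ^ (d + b + 1) - 1 := sub_pos.2 (one_lt_pow₀ hq (by omega))
    have h2 : 0 < q ^ (b + 1) - 1 := sub_pos.2 (one_lt_pow₀ hq (by omega))
    rw [gauss]
    positivity

/-- The new factor `(q ^ (d + b + 1) - 1) / (q ^ (b + 1) - 1)` is at least `q ^ d`. -/
lemma pow_mul_gauss_le (hq : 1 < q) (b d : ℕ) : q ^ d * gauss q b d ≤ gauss q (b + 1) d := by
  have h2 : 0 < q ^ (b + 1) - 1 := sub_pos.2 (one_lt_pow₀ hq (by omega))
  have h3 := gauss_pos hq b d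
  have h4 : 1 ≤ q ^ d := one_le_pow₀ hq.le
  rw [gauss, le_div_iff₀ h2, add_assoc, pow_add q d (b + 1)]
  nlinarith

lemma pow_pow_mul_gauss_le (hq : 1 < q) (b d s : ℕ) :
    (q ^ d) ^ s * gauss q b d ≤ gauss q (b + s) d := by
  induction s with
  | zero => simp
  | succ s ih =>
    have h : 0 < q ^ d := by positivity
    calc (q ^ d) ^ (s + 1) * gauss q b d = q ^ d * ((q ^ d) ^ s * gauss q b d) := by ring
      _ ≤ q ^ d * gauss q (b + s) d := by gcongr
      _ ≤ _ := pow_mul_gauss_le hq _ _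

lemma one_le_gauss (hq : 1 < q) (b d : ℕ) : 1 ≤ gauss q b d := by
  have h := pow_pow_mul_gauss_le hq 0 d b
  have h4 : 1 ≤ (q ^ d) ^ b := one_le_pow₀ (one_le_pow₀ hq.le)
  simp only [gauss, mul_one, zero_add] at h
  exact h4.trans h

lemma gauss_succ_right (hq : 1 < q) (b d : ℕ) :
    gauss q b (d + 1) * (q ^ (d + 1) - 1) = gauss q b d * (q ^ (d + b + 1) - 1) := by
  induction b with
  | zero => simp [gauss]
  | succ b ih =>
    have h2 : 0 < q ^ (b + 1) - 1 := sub_pos.2 (one_lt_pow₀ hq (by omega))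
    rw [gauss, gauss]
    field_simp
    rw [show d + (b + 1) + 1 = d + 1 + b + 1 by ring]
    linear_combination (q ^ (d + 1 + b + 1) - 1) * ih

lemma gauss_zero_right (hq : 1 < q) (b : ℕ) : gauss q b 0 = 1 := by
  induction b with
  | zero => simp [gauss]
  | succ b ih =>
    have h2 : 0 < q ^ (b + 1) - 1 := sub_pos.2 (one_lt_pow₀ hq (by omega))
    rw [gauss, ih, zero_add]
    field_simp

lemma gauss_one_right (hq : 1 < q) (b : ℕ) : gauss q b 1 = qnum q (b + 1) := by
  have h := gauss_succ_right hq b 0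
  have h1 : 0 < q - 1 := sub_pos.2 hq
  rw [gauss_zero_right hq] at h
  rw [qnum, eq_div_iff h1.ne']
  simpa using h

lemma gauss_one_left (d : ℕ) : gauss q 1 d = qnum q (d + 1) := by
  simp [gauss, qnum]

lemma qnum_succ (hq : 1 < q) (m : ℕ) : qnum q (m + 1) = q * qnum q m + 1 := by
  have h1 : q - 1 ≠ 0 := (sub_pos.2 hq).ne'
  rw [qnum, qnum]
  field_simp
  ring

lemma qnum_mul (hq : 1 < q) (m : ℕ) : qnum q m * (q - 1) = q ^ m - 1 :=
  div_mul_cancel₀ _ (sub_pos.2 hq).ne'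

lemma qnum_nonneg (hq : 1 < q) (m : ℕ) : 0 ≤ qnum q m :=
  div_nonneg (sub_nonneg.2 (one_le_pow₀ hq.le)) (sub_pos.2 hq).le

lemma seven_le_qnum (hq : 2 ≤ q) {m : ℕ} (hm : 3 ≤ m) : 7 ≤ qnum q m := by
  have hq1 : 1 < q := by linarith
  obtain ⟨m, rfl⟩ : ∃ m', m = m' + 1 + 1 + 1 := ⟨m - 3, by omega⟩
  have h1 := qnum_succ hq1 m
  have h2 := qnum_succ hq1 (m + 1)
  have h3 := qnum_succ hq1 (m + 1 + 1)
  have h0 := qnum_nonneg hq1 m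
  have h4 : 1 ≤ qnum q (m + 1) := by nlinarith
  have h5 : 3 ≤ qnum q (m + 1 + 1) := by nlinarith
  nlinarith

/-- Raising `s` costs a factor at most `4 / 3 * q ^ t`, because `q ^ (s + 1) ≥ 4`. The slack `6 / 7`
is there to cancel the loss `7 / 6` from the additive terms of `iterBound`. -/
lemma gauss_le (hq : 2 ≤ q) (t s : ℕ) (hs : 2 ≤ s) :
    7 * gauss q t s ≤ 6 * 2 ^ s * (q ^ t) ^ s := by
  have hq1 : 1 < q := by linarith
  have hstep : ∀ s, 1 ≤ s → gauss q t (s + 1) ≤ 4 / 3 * q ^ t * gauss q t s := by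
    intro s hs
    have h := gauss_succ_right hq1 t s
    have h4 : 4 ≤ q ^ (s + 1) := by
      calc (4 : ℚ) = 2 ^ 2 := by norm_num
        _ ≤ q ^ 2 := by gcongr
        _ ≤ q ^ (s + 1) := pow_le_pow_right₀ hq1.le (by omega)
    have hp := gauss_pos hq1 t s
    have hqt : 0 < q ^ t := by positivity
    have h5 : 0 < q ^ (s + 1) - 1 := by linarith
    refine le_of_mul_le_mul_right ?_ h5
    rw [h, show s + t + 1 = t + (s + 1) by ring, pow_add q t (s + 1)]
    have : q ^ t * q ^ (s + 1) - 1 ≤ 4 / 3 * q ^ t * (q ^ (s + 1) - 1) := by nlinarith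
    nlinarith
  have h1 : gauss q t 1 ≤ 2 * q ^ t := by
    rw [gauss_one_right hq1, qnum, div_le_iff₀ (by linarith), pow_succ]
    have : 0 < q ^ t := by positivity
    nlinarith
  have hqt : 0 < q ^ t := by positivity
  induction s, hs using Nat.le_induction with
  | base =>
    have h2 := hstep 1 le_rfl
    nlinarith
  | succ s hs ih =>
    have h2 := hstep s (by omega)
    have h3 : 0 < 6 * 2 ^ s * (q ^ t) ^ s := by positivity
    calc 7 * gauss q t (s + 1) ≤ 4 / 3 * q ^ t * (7 * gauss q t s) := by linarith
      _ ≤ 4 / 3 * q ^ t * (6 * 2 ^ s * (q ^ t) ^ s) := by gcongr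
      _ ≤ 2 * q ^ t * (6 * 2 ^ s * (q ^ t) ^ s) := by gcongr; norm_num
      _ = _ := by ring

/-- The bound obtained from `M` by `s` steps `x ↦ g * x + 1`. -/
def iterBound (g M : ℚ) : ℕ → ℚ
  | 0 => M
  | s + 1 => g * iterBound g M s + 1

/-- Geometric series, cleared of the denominator `g - 1`. -/
lemma iterBound_eq (g M : ℚ) (s : ℕ) :
    (g - 1) * iterBound g M s = (g - 1) * g ^ s * M + g ^ s - 1 := by
  induction s with
  | zero => simp [iterBound]
  | succ s ih =>
    rw [iterBound]
    linear_combination g * ih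

/-- Families with all almost-covers of dimension at least `t + s`, where `s ≥ 2`. Here `a` is the
dimension of the complement of a member in the ambient space, and `r = k - t - s`. -/
lemma bound_lt_of_two_le (hq : 2 ≤ q) {t s r a : ℕ} (hs : 2 ≤ s) (ht : 1 ≤ t)
    (ha : (3 ≤ q ∧ t + s + r + 1 ≤ a) ∨ t + s + r + 2 ≤ a) :
    1 + gauss q t s * iterBound (qnum q (s + r + 1)) (gauss q r a) s < gauss q (r + s) a := by
  have hq1 : 1 < q := by linarith
  set g := qnum q (s + r + 1) with hg
  set M := gauss q r a with hM
  set T := gauss q t s with hT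
  have hM1 : 1 ≤ M := one_le_gauss hq1 _ _
  have hq0 : 0 < q - 1 := by linarith
  have hg7 : 7 ≤ g := seven_le_qnum hq (by omega)
  have hT7 : 7 ≤ T := by
    obtain ⟨t, rfl⟩ : ∃ t', t = 1 + t' := ⟨t - 1, by omega⟩
    have h1 := pow_pow_mul_gauss_le hq1 1 s t
    have h2 : 1 ≤ (q ^ s) ^ t := one_le_pow₀ (one_le_pow₀ hq1.le)
    have h3 : 7 ≤ gauss q 1 s := by
      rw [gauss_one_left]
      exact seven_le_qnum hq (by omega)
    nlinarith
  have hgs : 0 < g ^ s := by positivity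
  -- The additive terms cost at most a factor `g / (g - 1) ≤ 7 / 6`.
  have hI : 6 * iterBound g M s ≤ 7 * (g ^ s * M) - 1 := by
    have h := iterBound_eq g M s
    have h1 : 1 ≤ g ^ s := one_le_pow₀ (by linarith)
    have h2 : g ^ s ≤ g ^ s * M := le_mul_of_one_le_right hgs.le hM1
    refine le_of_mul_le_mul_left ?_ (show 0 < g - 1 by linarith)
    nlinarith
  have hT2 := gauss_le hq t s hs
  have hlow := pow_pow_mul_gauss_le hq1 r a s
  -- The bound on `n` enters here: the factor 2 is absorbed by `q - 1` if `q ≥ 3`, and by one more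
  -- power of `q` otherwise.
  have hpow : 2 * q ^ t * g < q ^ a := by
    have hqt : 0 < q ^ t := by positivity
    have hgq : g * (q - 1) < q ^ (s + r + 1) := by
      rw [hg, qnum_mul hq1]
      linarith
    have h2 : q ^ t * (g * (q - 1)) < q ^ t * q ^ (s + r + 1) := by gcongr
    rw [← pow_add] at h2
    rcases ha with ⟨h3, ha⟩ | ha
    · have h4 : q ^ (t + (s + r + 1)) ≤ q ^ a := pow_le_pow_right₀ hq1.le (by omega)
      have h5 : q ^ t * (g * 2) ≤ q ^ t * (g * (q - 1)) := by gcongr; linarith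
      linarith
    · have h4 : q ^ (t + (s + r + 1) + 1) ≤ q ^ a := pow_le_pow_right₀ hq1.le (by omega)
      have h5 : q ^ t * (g * 1) ≤ q ^ t * (g * (q - 1)) := by gcongr; linarith
      have h6 : 0 < q ^ (t + (s + r + 1)) := by positivity
      rw [pow_succ] at h4
      nlinarith
  have hpow' : 2 ^ s * (q ^ t) ^ s * g ^ s < (q ^ a) ^ s := by
    rw [← mul_pow, ← mul_pow]
    exact pow_lt_pow_left₀ hpow (by positivity) (by omega)
  calc 1 + T * iterBound g M s ≤ T * (7 / 6 * (g ^ s * M)) := by nlinarith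
    _ = (7 * T) * (g ^ s * M) / 6 := by ring
    _ ≤ (6 * 2 ^ s * (q ^ t) ^ s) * (g ^ s * M) / 6 := by gcongr
    _ = 2 ^ s * (q ^ t) ^ s * g ^ s * M := by ring
    _ < (q ^ a) ^ s * M := by gcongr
    _ ≤ _ := hlow

/-- Families with an almost-cover of dimension `t + 1` and none of dimension `t`, where
`k = t + 1 + r`. -/
lemma bound_lt_of_eq_one (hq : 2 ≤ q) {t r a : ℕ} (ht : 1 ≤ t)
    (ha : (3 ≤ q ∧ t + r + 2 ≤ a) ∨ t + r + 3 ≤ a) :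
    1 + gauss q t 1 * iterBound (qnum q (r + 2)) (gauss q r a) 1 < gauss q (r + 1) a := by
  have hq1 : 1 < q := by linarith
  refine lt_of_lt_of_le ?_ (pow_mul_gauss_le hq1 r a)
  rw [gauss_one_right hq1, iterBound, iterBound]
  have hM1 := one_le_gauss hq1 r a
  set M := gauss q r a
  have hG := qnum_mul hq1 (t + 1)
  have hg := qnum_mul hq1 (r + 2)
  have hG0 := qnum_nonneg hq1 (t + 1)
  have hg0 := qnum_nonneg hq1 (r + 2)
  set G := qnum q (t + 1)
  set g := qnum q (r + 2)
  suffices h : 1 + G + G * g < q ^ a by nlinarith [mul_nonneg hG0 hg0]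
  have hp : q ≤ q ^ t := le_self_pow₀ hq1.le (by omega)
  have hz : q ≤ q ^ (r + 1) := le_self_pow₀ hq1.le (by omega)
  rcases ha with ⟨h3, ha⟩ | ha
  · have h4 : q ^ (t + (r + 1) + 1) ≤ q ^ a := pow_le_pow_right₀ hq1.le (by omega)
    -- `3 / 2` bounds `q / (q - 1)` for `q ≥ 3`; below, its square `9 / 4` leaves room under 3.
    have hG' : G ≤ 3 / 2 * q ^ t := by
      refine le_of_mul_le_mul_right ?_ (show 0 < q - 1 by linarith)
      rw [hG, pow_succ]
      nlinarith
    have hg' : g ≤ 3 / 2 * q ^ (r + 1) := by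
      refine le_of_mul_le_mul_right ?_ (show 0 < q - 1 by linarith)
      rw [hg, pow_succ q (r + 1)]
      nlinarith
    rw [pow_succ q (t + (r + 1)), pow_add q t (r + 1)] at h4
    set p := q ^ t
    set z := q ^ (r + 1)
    have h5 : G * g ≤ (3 / 2 * p) * (3 / 2 * z) := by gcongr
    have h6 : p * z * 3 ≤ p * z * q := by gcongr
    nlinarith
  · have h4 : q ^ ((t + 1) + (r + 2)) ≤ q ^ a := pow_le_pow_right₀ hq1.le (by omega)
    have hG' : G ≤ q ^ (t + 1) - 1 := by
      rw [← hG]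
      exact le_mul_of_one_le_right hG0 (by linarith)
    have hg' : g ≤ q ^ (r + 2) - 1 := by
      rw [← hg]
      exact le_mul_of_one_le_right hg0 (by linarith)
    have hy : 1 < q ^ (r + 2) := one_lt_pow₀ hq1 (by omega)
    rw [pow_add] at h4
    have h5 : G * (1 + g) ≤ (q ^ (t + 1) - 1) * q ^ (r + 2) := by
      gcongr
      · exact hG0.trans hG'
      · linarith
    nlinarith

/-- The case `k = t + 1` of families without an almost-cover of dimension `t`. -/
lemma bound_lt_of_eq_succ (hq : 2 ≤ q) {t a : ℕ} (ha : t + 2 ≤ a) :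
    1 + gauss q t 1 * iterBound (qnum q 2) (gauss q 0 a) 1 < gauss q 1 a := by
  have hq1 : 1 < q := by linarith
  have h0 := qnum_nonneg hq1 (t + 1)
  have h1 : qnum q (t + 3) ≤ qnum q (a + 1) := by
    rw [qnum, qnum]
    have : q ^ (t + 3) ≤ q ^ (a + 1) := pow_le_pow_right₀ hq1.le (by omega)
    gcongr
  have h2 : qnum q 2 = q + 1 := by
    rw [qnum, div_eq_iff (by linarith)]
    ring
  rw [gauss_one_left, gauss_one_right hq1, iterBound, iterBound, gauss, h2]
  rw [qnum_succ hq1 (t + 2), qnum_succ hq1 (t + 1)] at h1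
  -- The coefficient `q ^ 2 - q - 2` vanishes at `q = 2`, so no extra dimension is needed even
  -- there.
  nlinarith [mul_nonneg h0 (show 0 ≤ q ^ 2 - q - 2 by nlinarith)]

/-- Families all of whose members except one contain a fixed `t`-dimensional subspace. -/
lemma bound_lt_of_eq_zero (hq : 2 ≤ q) {d r a : ℕ} (ha : d + 1 ≤ a) (hd : 2 ≤ d) :
    2 + qnum q d * gauss q r a < gauss q (r + 1) a := by
  have hq1 : 1 < q := by linarith
  refine lt_of_lt_of_le ?_ (pow_mul_gauss_le hq1 r a)
  have hM1 := one_le_gauss hq1 r a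
  have hg := qnum_mul hq1 d
  have hg0 := qnum_nonneg hq1 d
  have hg' : qnum q d ≤ q ^ d := by nlinarith
  have h4 : q ^ (d + 1) ≤ q ^ a := pow_le_pow_right₀ hq1.le ha
  have h5 : 4 ≤ q ^ d := by
    calc (4 : ℚ) ≤ q ^ 2 := by nlinarith
      _ ≤ q ^ d := pow_le_pow_right₀ hq1.le hd
  rw [pow_succ] at h4
  have h6 : qnum q d + 4 ≤ q ^ a := by nlinarith
  nlinarith

end Numerics

/-! ### Almost-covers and the size of families. -/

section Families

open Classical

variable {K V : Type*} [Field K] [AddCommGroup V] [Module K V]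

/-- All members of `S` except at most one meet `T` in dimension at least `t`. -/
def IsAlmostCover (t : ℕ) (S : Finset (Submodule K V)) (T : Submodule K V) : Prop :=
  {F ∈ (S : Set (Submodule K V)) | finrank K (T ⊓ F : Submodule K V) < t}.Subsingleton

lemma IsAlmostCover.card_le {t : ℕ} {S R : Finset (Submodule K V)} {T : Submodule K V}
    (h : IsAlmostCover t S T) (hR : R ⊆ S) :
    R.card ≤ (R.filter fun F => t ≤ finrank K (T ⊓ F : Submodule K V)).card + 1 := by
  rw [← card_filter_add_card_filter_not (s := R)
    (p := fun F => t ≤ finrank K (T ⊓ F : Submodule K V))]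
  gcongr
  rw [card_le_one]
  intro A hA B hB
  simp only [mem_filter, not_le] at hA hB
  exact h ⟨hR hA.1, hA.2⟩ ⟨hR hB.1, hB.2⟩

variable [Finite K] [FiniteDimensional K V] [Fintype (Submodule K V)]

/-- If no subspace of dimension in `[t, ℓ)` meets all members of `S` in dimension at least `t`,
then few members of `S` contain a given subspace. -/
lemma card_filter_le_iterBound {t d ℓ r a : ℕ} {S : Finset (Submodule K V)}
    (hS : (S : Set (Submodule K V)) ⊆ subspacesOfDim K V (ℓ + r))
    (hV : finrank K V = ℓ + r + a) (hd : ℓ + r + 1 = t + d)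
    (hT : IsAlmostTIntersecting t (S : Set (Submodule K V)))
    (hℓ : ∀ U : Submodule K V, t ≤ finrank K U → finrank K U < ℓ →
      ∃ B ∈ S, finrank K (U ⊓ B : Submodule K V) < t) (s : ℕ) :
    ∀ U : Submodule K V, t ≤ finrank K U → finrank K U + s = ℓ →
      ((S.filter fun F => U ≤ F).card : ℚ) ≤
        iterBound (qnum (Nat.card K) d) (gauss (Nat.card K) r a) s := by
  induction s with
  | zero =>
    intro U _ hU
    rw [iterBound, ← card_between r (U := U) (W := ⊤) le_top (by rw [finrank_top]; omega)]
    gcongr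
    intro F hF
    rw [mem_filter] at hF
    rw [mem_between]
    have : finrank K F = ℓ + r := hS hF.1
    exact ⟨hF.2, le_top, by omega⟩
  | succ s ih =>
    intro U htU hU
    obtain ⟨B, hB, hUB⟩ := hℓ U htU (by omega)
    have hBk : finrank K B = ℓ + r := hS hB
    -- As `B` is a member, at most one member escapes the branching; this is the `+ 1` in
    -- `iterBound`.
    have hcov : IsAlmostCover t S B := hT B hB
    have h1 := hcov.card_le (filter_subset (fun F => U ≤ F) S)
    have h2 := card_le_of_forall_le_finrank_inf (d := d) hUB (by omega)
      ((S.filter fun F => U ≤ F).filter fun F => t ≤ finrank K (B ⊓ F : Submodule K V))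
      (fun F hF => (mem_filter.1 (mem_filter.1 hF).1).2)
      (fun F hF => by rw [inf_comm]; exact (mem_filter.1 hF).2)
      (M := iterBound (qnum (Nat.card K) d) (gauss (Nat.card K) r a) s)
      (fun U' _ hU' => by
        refine le_trans ?_ (ih U' (by omega) (by omega))
        refine Nat.cast_le.2 (card_le_card fun F hF => ?_)
        simp only [mem_filter] at hF ⊢
        exact ⟨hF.1.1.1, hF.2⟩)
    rw [iterBound]
    have h3 := (Nat.cast_le (α := ℚ)).2 h1
    push_cast at h3
    linarith

/-- Upper bound for an almost `t`-intersecting family with an almost-cover of dimension `t + s`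
and no smaller cover. -/
lemma card_le_of_isAlmostCover {t s r a : ℕ} {S : Finset (Submodule K V)}
    (hS : (S : Set (Submodule K V)) ⊆ subspacesOfDim K V (t + s + r))
    (hV : finrank K V = t + s + r + a)
    (hT : IsAlmostTIntersecting t (S : Set (Submodule K V)))
    (hℓ : ∀ U : Submodule K V, t ≤ finrank K U → finrank K U < t + s →
      ∃ B ∈ S, finrank K (U ⊓ B : Submodule K V) < t)
    {T : Submodule K V} (hcov : IsAlmostCover t S T) (hTs : finrank K T = t + s) :
    (S.card : ℚ) ≤ 1 + gauss (Nat.card K) t s *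
      iterBound (qnum (Nat.card K) (s + r + 1)) (gauss (Nat.card K) r a) s := by
  have h1 := (Nat.cast_le (α := ℚ)).2 (hcov.card_le (Subset.refl S))
  have hcard := card_between t (U := ⊥) (W := T) (d := s) bot_le (by simp [hTs])
  -- Each such member contains a `t`-subspace of `T`, from which the iteration starts.
  have hsub : (S.filter fun F => t ≤ finrank K (T ⊓ F : Submodule K V)) ⊆
      (between ⊥ T (finrank K (⊥ : Submodule K V) + t)).biUnion
        fun E => S.filter fun F => E ≤ F := by
    intro F hF
    rw [mem_filter] at hF
    obtain ⟨E, hE, hEt⟩ := exists_le_finrank_eq (T ⊓ F) hF.2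
    rw [mem_biUnion]
    refine ⟨E, ?_, mem_filter.2 ⟨hF.1, hE.trans inf_le_right⟩⟩
    rw [mem_between]
    exact ⟨bot_le, hE.trans inf_le_left, by simp [hEt]⟩
  have h2 := (Nat.cast_le (α := ℚ)).2 ((card_le_card hsub).trans card_biUnion_le)
  rw [Nat.cast_sum] at h2
  have h3 := h2.trans (sum_le_card_nsmul _ _ _ fun E hE => by
    rw [mem_between, finrank_bot] at hE
    exact card_filter_le_iterBound (d := s + r + 1) hS hV (by omega) hT hℓ s E
      (by omega) (by omega))
  rw [nsmul_eq_mul, hcard] at h3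
  push_cast at h1
  linarith

/-- The number of `k`-dimensional subspaces containing a given `t`-dimensional one. -/
lemma card_between_top {t b a : ℕ} (hV : finrank K V = t + b + a) {E : Submodule K V}
    (hE : finrank K E = t) :
    ((between E ⊤ (t + b)).card : ℚ) = gauss (Nat.card K) b a := by
  subst hE
  exact card_between b le_top (by rw [finrank_top]; omega)

/-- If exactly one member of an almost `t`-intersecting family fails to contain `E`, then the
family is small. -/
lemma card_le_of_not_le {t r a : ℕ} {S : Finset (Submodule K V)}
    (hS : (S : Set (Submodule K V)) ⊆ subspacesOfDim K V (t + 1 + r))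
    (hV : finrank K V = t + 1 + r + a)
    (hT : IsAlmostTIntersecting t (S : Set (Submodule K V)))
    {E B : Submodule K V} (hE : finrank K E = t) (hB : B ∈ S)
    (hEB : finrank K (E ⊓ B : Submodule K V) < t) (hcov : IsAlmostCover t S E) :
    (S.card : ℚ) ≤ 2 + qnum (Nat.card K) (r + 2) * gauss (Nat.card K) r a := by
  have hBk : finrank K B = t + 1 + r := hS hB
  have hle : ∀ F : Submodule K V, t ≤ finrank K (E ⊓ F : Submodule K V) → E ≤ F := by
    intro F hF
    have : E ⊓ F = E := Submodule.eq_of_le_of_finrank_le inf_le_left (hE ▸ hF)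
    exact inf_eq_left.1 this
  -- The constant 2 allows for `B` itself and for one member meeting `B` in dimension less than `t`.
  have h1 := hcov.card_le (Subset.refl S)
  have h2 := IsAlmostCover.card_le (T := B) (hT B hB)
    (filter_subset (fun F => t ≤ finrank K (E ⊓ F : Submodule K V)) S)
  have h3 := card_le_of_forall_le_finrank_inf (d := r + 2) hEB (by omega)
    ((S.filter fun F => t ≤ finrank K (E ⊓ F : Submodule K V)).filter
      fun F => t ≤ finrank K (B ⊓ F : Submodule K V))
    (fun F hF => hle F (mem_filter.1 (mem_filter.1 hF).1).2)
    (fun F hF => by rw [inf_comm]; exact (mem_filter.1 hF).2)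
    (M := gauss (Nat.card K) r a)
    (fun U' _ hU' => by
      rw [hE] at hU'
      rw [← card_between_top hV hU']
      gcongr
      intro F hF
      simp only [mem_filter] at hF
      rw [mem_between]
      exact ⟨hF.2, le_top, hS hF.1.1.1⟩)
  have h4 := (Nat.cast_le (α := ℚ)).2 (h1.trans (Nat.add_le_add_right h2 1))
  push_cast at h4
  linarith

/-- A sufficiently large almost `t`-intersecting family consists of subspaces containing a fixed
`t`-dimensional subspace. -/
lemma exists_forall_le_of_gauss_le_card {t c a : ℕ} {S : Finset (Submodule K V)}
    (ht : 1 ≤ t)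
    (hS : (S : Set (Submodule K V)) ⊆ subspacesOfDim K V (t + 1 + c))
    (hV : finrank K V = t + 1 + c + a)
    (ha : t + c + 2 ≤ a)
    (ha' : c = 0 ∨ 3 ≤ Nat.card K ∨ t + c + 3 ≤ a)
    (hT : IsAlmostTIntersecting t (S : Set (Submodule K V)))
    (hcard : gauss (Nat.card K) (c + 1) a ≤ S.card) :
    ∃ E : Submodule K V, finrank K E = t ∧ ∀ F ∈ S, E ≤ F := by
  have hq1 : (1 : ℚ) < Nat.card K := one_lt_natCard K
  have hq : (2 : ℚ) ≤ Nat.card K := by exact_mod_cast hq1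
  obtain ⟨A, hA⟩ : S.Nonempty := by
    rw [← card_pos]
    have := (gauss_pos hq1 (c + 1) a).trans_le hcard
    exact_mod_cast this
  have hAk : finrank K A = t + 1 + c := hS hA
  have hex : ∃ s, ∃ T : Submodule K V, finrank K T = t + s ∧ IsAlmostCover t S T :=
    ⟨1 + c, A, by omega, hT A hA⟩
  obtain ⟨T, hTs, hcov⟩ := Nat.find_spec hex
  have hmin : ∀ U : Submodule K V, t ≤ finrank K U → finrank K U < t + Nat.find hex →
      ∃ B ∈ S, finrank K (U ⊓ B : Submodule K V) < t := by
    intro U hU hUs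
    by_contra! h
    -- A space meeting every member in dimension at least `t` would be a smaller almost-cover.
    refine Nat.find_min hex (m := finrank K U - t) (by omega) ⟨U, by omega, ?_⟩
    rintro F ⟨hF, hF'⟩
    exact absurd hF' (h F hF).not_gt
  have hsle : Nat.find hex ≤ 1 + c := Nat.find_min' hex ⟨A, by omega, hT A hA⟩
  set s := Nat.find hex
  rcases Nat.eq_zero_or_pos s with hs0 | hs0
  · have hTt : finrank K T = t := by omega
    refine ⟨T, hTt, ?_⟩
    by_contra! h
    obtain ⟨B, hB, hTB⟩ := h
    have hlt : finrank K (T ⊓ B : Submodule K V) < t := by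
      rw [← hTt]
      refine Submodule.finrank_lt_finrank_of_lt (inf_le_left.lt_of_ne fun h => hTB ?_)
      exact inf_eq_left.1 h
    have h1 := card_le_of_not_le hS hV hT hTt hB hlt hcov
    have h2 := bound_lt_of_eq_zero hq (d := c + 2) (r := c) (a := a) (by omega) (by omega)
    linarith
  · exfalso
    obtain ⟨r, hr⟩ : ∃ r, 1 + c = s + r := ⟨1 + c - s, by omega⟩
    rw [show t + 1 + c = t + s + r by omega] at hS hV
    have h1 := card_le_of_isAlmostCover hS hV hT hmin hcov hTs
    rw [show c + 1 = r + s by omega] at hcard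
    have h3 : c ≠ 0 → ((3 : ℚ) ≤ Nat.card K ∧ t + s + r + 1 ≤ a) ∨ t + s + r + 2 ≤ a := by
      intro hc
      rcases ha' with h | h | h
      · exact absurd h hc
      · exact Or.inl ⟨by exact_mod_cast h, by omega⟩
      · exact Or.inr (by omega)
    have h2 : 1 + gauss (Nat.card K) t s * iterBound (qnum (Nat.card K) (s + r + 1))
        (gauss (Nat.card K) r a) s < gauss (Nat.card K) (r + s) a := by
      rcases Nat.lt_or_ge 1 s with hs | hs
      · exact bound_lt_of_two_le hq hs ht (h3 (by omega))
      · have hs1 : s = 1 := by omega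
        rw [hs1] at hr h3 ⊢
        rw [show 1 + r + 1 = r + 2 by omega]
        by_cases hc : c = 0
        · obtain rfl : r = 0 := by omega
          exact bound_lt_of_eq_succ hq (by omega)
        · exact bound_lt_of_eq_one hq ht (by
            rcases h3 hc with h | h
            · exact Or.inl ⟨h.1, by omega⟩
            · exact Or.inr (by omega))
    linarith

end Families

end AlmostIntersecting

/-! ### The main theorem: comparison with a star. -/

theorem theorem1p1 {K V : Type*} [Field K] [Finite K] [AddCommGroup V] [Module K V]
    [FiniteDimensional K V] (q n k t : ℕ) (hq : Nat.card K = q) (hV : Module.finrank K V = n)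
    (ht : 1 ≤ t) (hk : t + 1 ≤ k)
    (hn : 2 * k + 1 + AlmostIntersecting.delta 2 q *
      (1 - AlmostIntersecting.delta k (t + 1)) ≤ n)
    (𝓕 : Set (Submodule K V))
    (h𝓕 : AlmostIntersecting.IsMaximumAlmostTIntersecting k t 𝓕) :
    (∃ E ∈ AlmostIntersecting.subspacesOfDim K V t,
      𝓕 = {F ∈ AlmostIntersecting.subspacesOfDim K V k | E ≤ F}) ∧
    AlmostIntersecting.IsTIntersecting t 𝓕 := by
  open AlmostIntersecting in
  classical
  have : Finite V := Module.finite_of_finite K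
  have : Fintype (Submodule K V) := Fintype.ofFinite _
  obtain ⟨h𝓕k, h𝓕t, hmax⟩ := h𝓕
  have hstar : ∀ E ∈ subspacesOfDim K V t,
      IsTIntersecting t {F ∈ subspacesOfDim K V k | E ≤ F} := by
    intro E hE F₁ h₁ F₂ h₂
    rw [← show Module.finrank K E = t from hE]
    exact Submodule.finrank_mono (le_inf h₁.2 h₂.2)
  have hstar_le : ∀ E ∈ subspacesOfDim K V t,
      {F ∈ subspacesOfDim K V k | E ≤ F}.ncard ≤ 𝓕.ncard := by
    intro E hE
    refine hmax _ (fun F hF => hF.1) ?_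
    rintro F hF G ⟨hG, hlt⟩
    exact absurd hlt (hstar E hE F hF G hG).not_gt
  obtain ⟨c, rfl⟩ : ∃ c, k = t + 1 + c := ⟨k - (t + 1), by omega⟩
  obtain ⟨a, hna⟩ : ∃ a, n = t + 1 + c + a := ⟨n - (t + 1 + c), by omega⟩
  have ha' : c = 0 ∨ 3 ≤ Nat.card K ∨ t + c + 3 ≤ a := by
    have h2 : 1 < Nat.card K := Finite.one_lt_card
    by_cases hq2 : 2 = q
    · by_cases hc : c = 0
      · exact Or.inl hc
      · simp [delta, ← hq2, hc] at hn
        omega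
    · omega
  set S := 𝓕.toFinset with hSdef
  have hSF : (S : Set (Submodule K V)) = 𝓕 := Set.coe_toFinset 𝓕
  have hScard : 𝓕.ncard = S.card := by rw [← hSF, Set.ncard_coe_finset]
  have hcard : gauss (Nat.card K) (c + 1) a ≤ S.card := by
    obtain ⟨E, -, hE⟩ := exists_le_finrank_eq (⊤ : Submodule K V) (d := t)
      (by rw [finrank_top]; omega)
    rw [← card_between_top (t := t) (b := c + 1) (by omega) hE, ← hScard]
    refine Nat.cast_le.2 (le_trans (le_of_eq ?_) (hstar_le E hE))
    rw [← Set.ncard_coe_finset]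
    congr 1
    ext F
    simp only [Finset.mem_coe, mem_between, subspacesOfDim, Set.mem_ofPred_eq, le_top, true_and]
    rw [and_comm, show t + (c + 1) = t + 1 + c by omega]
  obtain ⟨E, hE, hle⟩ := exists_forall_le_of_gauss_le_card (c := c) (a := a) ht
    (hSF ▸ h𝓕k) (by omega) (by omega) ha' (hSF ▸ h𝓕t) hcard
  -- The family lies in the star of `E`, and maximality makes it at least as large.
  have heq : 𝓕 = {F ∈ subspacesOfDim K V (t + 1 + c) | E ≤ F} :=
    Set.eq_of_subset_of_ncard_le (fun F hF => ⟨h𝓕k hF, hle F (Set.mem_toFinset.2 hF)⟩)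
      (hstar_le E hE) (Set.toFinite _)
  exact ⟨⟨E, hE, heq⟩, heq ▸ hstar E hE⟩
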